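/- There are absolute constants $c\in\mathbb N$ and $C>0$ such that the following holds for every integer $t\ge 1$. There is a decoding function $D$, depending only on $t$, such that for every finite undirected graph $G=(V,E)$ with non-negative edge weights and every priority ranking $x_1,\dots,x_n$ of its vertices one can assign to each vertex $v$ a label $L(v)$ (a finite sequence of words) with the following properties. (1) Words: each word of a label holds either a non-negative integer of at most $c\,(\lfloor\log_2 n\rfloor+1)$ bits or one of the values $d_G(u,v)$ with $u,v\in V$, where $d_G$ is the shortest-path distance of the weighted graph $G$ ($d_G(u,v)=\infty$ if $u$ and $v$ are not connected). (2) Stretch $2t-1$ for all pairs: for all $u,v\in V$, $$d_G(u,v)\ \le\ D(L(u),L(v))\ \le\ (2t-1)\cdot d_G(u,v).$$ (3) Prioritized label size: for every $1\le j\le n$, the label $L(x_j)$ consists of at most $C\cdot j^{1/t}\cdot\log_2 j$ words; this bound does not depend on $n$. (For $j=1$ it says that $L(x_1)$ is the empty label.) -/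

import Mathlib

open scoped NNReal ENNReal

namespace DistLabel

/-- Total weight of a walk in an undirected graph with non-negative edge weights `w`. -/
noncomputable def walkLength {V : Type*} {G : SimpleGraph V} (w : Sym2 V → ℝ≥0)
    {u v : V} (p : G.Walk u v) : ℝ≥0 :=
  (p.edges.map w).sum

/-- Shortest-path distance of the weighted graph `(G, w)`; it is `∞` exactly when no walk joins
the two vertices. -/
noncomputable def graphDist {V : Type*} (G : SimpleGraph V) (w : Sym2 V → ℝ≥0) (u v : V) :
    ℝ≥0∞ :=
  ⨅ p : G.Walk u v, (walkLength w p : ℝ≥0∞)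

/-- The content of one memory word of a label: an integer or a distance. -/
inductive Word where
  | num (k : ℕ)
  | dist (d : ℝ≥0∞)

/-- A label is a finite sequence of words; its size is its length. -/
abbrev Label := List Word

/-- What a word may hold for the `n`-vertex weighted graph `(G, w)`: an integer of at most
`c * Nat.size n`, that is `O(log n)`, bits, or one of the distances of the graph. Arbitrary real
numbers are not allowed, since a single one could encode the whole graph. -/
def Word.Fits {V : Type*} (c n : ℕ) (G : SimpleGraph V) (w : Sym2 V → ℝ≥0) : Word → Prop
  | .num k => Nat.size k ≤ c * Nat.size n
  | .dist d => ∃ u v : V, d = graphDist G w u v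

/-- All labels are made of words which fit (with `c * Nat.size n` bits for the integers). -/
def UsesWords {V : Type*} (c n : ℕ) (G : SimpleGraph V) (w : Sym2 V → ℝ≥0)
    (label : V → Label) : Prop :=
  ∀ v : V, ∀ a ∈ label v, a.Fits c n G w

/-- For every pair of vertices, the estimate which `decode` computes from their two labels alone
is at least the distance and at most `α` times the distance. -/
def HasStretch {V : Type*} (G : SimpleGraph V) (w : Sym2 V → ℝ≥0)
    (decode : Label → Label → ℝ≥0∞) (label : V → Label) (α : ℝ≥0∞) : Prop :=
  ∀ u v : V, graphDist G w u v ≤ decode (label u) (label v) ∧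
    decode (label u) (label v) ≤ α * graphDist G w u v

/-- With respect to the priority ranking `x` (the vertex of rank `j`, `1 ≤ j ≤ n`, is `x i` with
`j = i + 1`), the label of the vertex of rank `j` consists of at most `β j` words. -/
def HasPrioritizedLabelSize {V : Type*} {n : ℕ} (x : Fin n ≃ V) (label : V → Label)
    (β : ℕ → ℝ) : Prop :=
  ∀ i : Fin n, ((label (x i)).length : ℝ) ≤ β ((i : ℕ) + 1)

end DistLabel

/-!
The labels are hub labels. The label of a vertex lists some vertices, its hubs, each with its
distance, and the estimate for a pair is the length of the shortest detour through a common hub.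
By the triangle inequality it never underestimates, so what has to be found are small hub sets
such that any two vertices have a common hub with a detour of stretch `2 * t - 1`
(`exists_prioritized_hubs`).

For a set `S` of sources, the Thorup–Zwick construction with `T ≤ t` levels provides hubs for all
pairs one of whose members lies in `S` (`exists_hierarchy`): each level is a random sample, with
density `p`, of the one below, where `p ^ T * |S| ≤ 1`, and a vertex stores its bunch and its pivot
at each level. The sources of scale `i` are the first `2 ^ E i` vertices of the ranking, and a
vertex takes part in the scales up to the first one which has it as a source. Hence two vertices
share the scale of the one of higher priority, and the label size depends on the rank alone.

For the size, the exponents are `E (i + 1) = E i + min (E i) t`, with `T i = min (E i) t` levels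
and density `p i = 2 ^ -(E i / t + 1)`. The levels of all scales used by the vertex of rank `j` then
telescope to `O(log j)`, and `1 / p i` is `O(j ^ (1 / t))` at its last scale. The bunches of
a vertex below the top level have the sizes of waiting times with parameter `p i`
(`subsetMean_bunch_le`), and the top level has at most `1 / p i` points in the mean, so
`∏ i, (1 + p i / 2) ^ (size at scale i) / 3 ^ T i` has mean at most `1`; averaging the sum of these
products over all vertices, with weights `1 / (j * (j + 1))` of total at most `1`, yields one choice
of samples that is good for every vertex (`exists_isHubs_family`). Taking logarithms gives
`O(j ^ (1 / t) * log j)` hubs.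

The vertex of rank `1` is a hub of every vertex, which is why its own label may be empty.
-/

namespace DistLabel

/-! ### Averaging over random subsets -/

section Averaging

variable {V : Type*}

/-- The expectation of `f s` for a random subset `s` of `A` that contains each element
independently with probability `p`. -/
noncomputable def subsetMean (p : ℝ) (A : Finset V) (f : Finset V → ℝ) : ℝ :=
  ∑ s ∈ A.powerset, p ^ s.card * (1 - p) ^ (A.card - s.card) * f s

lemma subsetMean_insert [DecidableEq V] (p : ℝ) {A : Finset V} {a : V} (ha : a ∉ A)
    (f : Finset V → ℝ) : subsetMean p (insert a A) f =
      (1 - p) * subsetMean p A f + p * subsetMean p A (fun s => f (insert a s)) := by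
  unfold subsetMean
  rw [Finset.sum_powerset_insert ha, Finset.mul_sum, Finset.mul_sum]
  congr 1 <;> refine Finset.sum_congr rfl fun s hs => ?_
  · have hsA := Finset.card_le_card (Finset.mem_powerset.1 hs)
    rw [Finset.card_insert_of_notMem ha, Nat.sub_add_comm hsA, pow_succ]
    ring
  · have has : a ∉ s := fun h => ha (Finset.mem_powerset.1 hs h)
    rw [Finset.card_insert_of_notMem ha, Finset.card_insert_of_notMem has,
      Nat.add_sub_add_right, pow_succ]
    ring

lemma subsetMean_mono {p : ℝ} (hp0 : 0 ≤ p) (hp1 : p ≤ 1) (A : Finset V)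
    {f g : Finset V → ℝ} (h : ∀ s, s ⊆ A → f s ≤ g s) : subsetMean p A f ≤ subsetMean p A g := by
  have : 0 ≤ 1 - p := by linarith
  refine Finset.sum_le_sum fun s hs => ?_
  have := h s (Finset.mem_powerset.1 hs)
  gcongr

lemma subsetMean_mul_left (p c : ℝ) (A : Finset V) (f : Finset V → ℝ) :
    subsetMean p A (fun s => c * f s) = c * subsetMean p A f := by
  unfold subsetMean
  rw [Finset.mul_sum]
  exact Finset.sum_congr rfl fun s _ => by ring

lemma subsetMean_sum {ι : Type*} (p : ℝ) (A : Finset V) (I : Finset ι) (f : ι → Finset V → ℝ) :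
    subsetMean p A (fun s => ∑ i ∈ I, f i s) = ∑ i ∈ I, subsetMean p A (f i) := by
  unfold subsetMean
  simp_rw [Finset.mul_sum]
  exact Finset.sum_comm

lemma subsetMean_pow_card (p y : ℝ) (A : Finset V) :
    subsetMean p A (fun s => y ^ s.card) = (1 + p * (y - 1)) ^ A.card := by
  have h := Finset.sum_pow_mul_eq_add_pow (p * y) (1 - p) A
  rw [show p * y + (1 - p) = 1 + p * (y - 1) by ring] at h
  rw [← h]
  exact Finset.sum_congr rfl fun s _ => by rw [mul_pow]; ring

lemma exists_subset_le_of_subsetMean_le {p : ℝ} (hp0 : 0 < p) (hp1 : p ≤ 1) (A : Finset V)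
    {f : Finset V → ℝ} {M : ℝ} (h : subsetMean p A f ≤ M) : ∃ s ⊆ A, f s ≤ M := by
  by_contra! hc
  have h1 : subsetMean p A (fun _ => M) = M := by
    have := subsetMean_pow_card p 1 A
    have h2 := subsetMean_mul_left p M A (fun s => (1 : ℝ) ^ s.card)
    simp only [one_pow, mul_one, sub_self, mul_zero, add_zero] at this h2
    rw [h2, this, mul_one]
  have h3 : subsetMean p A (fun _ => M) < subsetMean p A f := by
    have h0 : 0 ≤ 1 - p := by linarith
    refine Finset.sum_lt_sum (fun s hs => ?_) ⟨A, Finset.mem_powerset_self A, ?_⟩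
    · have := (hc s (Finset.mem_powerset.1 hs)).le
      gcongr
    · have := hc A subset_rfl
      simp only [Nat.sub_self, pow_zero, mul_one]
      gcongr
  linarith

end Averaging

/-! ### Bunches and hub sets of a sampling hierarchy -/

section Hubs

variable {V : Type*} (d : V → V → ℝ≥0∞)

/-- The bunch of `v`: the points of `A` that are strictly closer to `v` than every point of the
sample `s`; it is all of `A` if the sample is empty. -/
noncomputable def bunch (v : V) (A s : Finset V) : Finset V :=
  A.filter fun a => ∀ b ∈ s, d v a < d v b

lemma mem_bunch {v a : V} {A s : Finset V} :
    a ∈ bunch d v A s ↔ a ∈ A ∧ ∀ b ∈ s, d v a < d v b :=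
  Finset.mem_filter

/-- The pivot of `v`, a nearest point of the sample `s`, as a set which is empty if `s` is. -/
lemma exists_pivot (s : Finset V) (v : V) :
    ∃ P : Finset V, P.card ≤ 1 ∧ ∀ b ∈ s, ∃ g ∈ P, g ∈ s ∧ d v g ≤ d v b := by
  rcases s.eq_empty_or_nonempty with rfl | hs
  · exact ⟨∅, by simp⟩
  · obtain ⟨g, hg, hmin⟩ := s.exists_min_image (d v) hs
    exact ⟨{g}, by simp, fun b hb => ⟨g, by simp, hg, hmin b hb⟩⟩

variable [DecidableEq V]

/-- The moment bound for one sampling step. Revealing the points of `A` in the order of their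
distance from `v`, the size of the bunch is the waiting time for the first sampled point; the
factor `y ^ s.card` carries the cost of the later steps. -/
lemma subsetMean_bunch_le {p y : ℝ} (hp0 : 0 ≤ p) (hp1 : p ≤ 1) (hy : 1 ≤ y) (v : V)
    (A : Finset V) :
    subsetMean p A (fun s => (1 + p / 2) ^ (bunch d v A s).card * y ^ s.card) ≤
      2 * (1 + p * (y - 1)) ^ A.card := by
  induction A using Finset.induction_on_min_value (fun a => d v a) with
  | empty => simp [subsetMean, bunch]
  | insert a A ha hmin ih =>
    have hq : 0 ≤ 1 - p := by linarith
    set z := 1 + p * (y - 1) with hz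
    have hz1 : 1 ≤ z := by nlinarith [mul_nonneg hp0 (sub_nonneg.2 hy)]
    -- If the nearest point is not sampled, the bunch grows by at most that point.
    have h1 : subsetMean p A
          (fun s => (1 + p / 2) ^ (bunch d v (insert a A) s).card * y ^ s.card) ≤
        (1 + p / 2) * (2 * z ^ A.card) := by
      refine le_trans ?_ (mul_le_mul_of_nonneg_left ih (by linarith))
      rw [← subsetMean_mul_left]
      refine subsetMean_mono hp0 hp1 A fun s _ => ?_
      have hcard : (bunch d v (insert a A) s).card ≤ (bunch d v A s).card + 1 := by
        refine le_trans (Finset.card_le_card ?_) (Finset.card_insert_le a _)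
        intro b hb
        simp only [mem_bunch, Finset.mem_insert] at hb ⊢
        tauto
      have : (1 + p / 2) ^ (bunch d v (insert a A) s).card ≤
          (1 + p / 2) ^ ((bunch d v A s).card + 1) :=
        pow_le_pow_right₀ (by linarith) hcard
      calc _ ≤ (1 + p / 2) ^ ((bunch d v A s).card + 1) * y ^ s.card := by gcongr
        _ = _ := by rw [pow_succ]; ring
    -- If the nearest point is sampled, the bunch is empty.
    have h2 : subsetMean p A (fun s => (1 + p / 2) ^ (bunch d v (insert a A) (insert a s)).card *
        y ^ (insert a s).card) = y * z ^ A.card := by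
      rw [← subsetMean_pow_card, ← subsetMean_mul_left]
      refine Finset.sum_congr rfl fun s hs => ?_
      have hb : bunch d v (insert a A) (insert a s) = ∅ := by
        refine Finset.filter_eq_empty_iff.2 fun b hb h => ?_
        have h' := h a (Finset.mem_insert_self a s)
        rcases Finset.mem_insert.1 hb with rfl | hb
        · exact lt_irrefl _ h'
        · exact absurd h' (not_lt.2 (hmin b hb))
      have has : a ∉ s := fun h => ha (Finset.mem_powerset.1 hs h)
      simp only [hb, Finset.card_empty, pow_zero, one_mul, Finset.card_insert_of_notMem has,
        pow_succ]
      ring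
    rw [subsetMean_insert p ha, h2, Finset.card_insert_of_notMem ha, pow_succ]
    have hzA : 0 ≤ z ^ A.card := by positivity
    have key : (1 - p) * ((1 + p / 2) * 2) + p * y ≤ 2 * z := by
      rw [hz]; nlinarith [mul_nonneg hp0 (sub_nonneg.2 hy), mul_nonneg hp0 hp0]
    nlinarith [mul_le_mul_of_nonneg_left h1 hq, mul_le_mul_of_nonneg_right key hzA]

lemma exists_sample [Fintype V] {p y : ℝ} (hp0 : 0 < p) (hp1 : p ≤ 1) (hy : 1 ≤ y)
    (A : Finset V) {W : V → ℝ} (hW : ∀ v, 0 ≤ W v) :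
    ∃ s ⊆ A, ∑ v, W v * ((1 + p / 2) ^ (bunch d v A s).card * y ^ s.card) ≤
      (∑ v, W v) * (2 * (1 + p * (y - 1)) ^ A.card) := by
  refine exists_subset_le_of_subsetMean_le hp0 hp1 A ?_
  rw [subsetMean_sum, Finset.sum_mul]
  refine Finset.sum_le_sum fun v _ => ?_
  rw [subsetMean_mul_left]
  exact mul_le_mul_of_nonneg_left (subsetMean_bunch_le d hp0.le hp1 hy v A) (hW v)

/-- A hierarchy of `k` sampling steps above `A`. The first property is the step of the
Thorup–Zwick query: a point `h` of `A` near `u` either is a hub of `v` or can be exchanged for a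
pivot of `v` one level higher, which costs one more `d u v`. In the second one, each step costs
a factor `2` for the bunch and at most `3 / 2` for the pivot. -/
lemma exists_hierarchy [Fintype V] (hsymm : ∀ u v, d u v = d v u)
    (htri : ∀ u v w, d u w ≤ d u v + d v w) {p : ℝ} (hp0 : 0 < p) (hp1 : p ≤ 1) (k : ℕ)
    (A : Finset V) {W : V → ℝ} (hW : ∀ v, 0 ≤ W v) :
    ∃ H : V → Finset V,
      (∀ u v, ∀ h ∈ A, ∀ a : ℕ, d u h ≤ a * d u v →
        ∃ g ∈ H v, (g = h ∨ g ∈ H u) ∧ d u g + d v g ≤ ((2 * a + 2 * k + 1 : ℕ) : ℝ≥0∞) * d u v) ∧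
      ∑ v, W v * (1 + p / 2) ^ (H v).card ≤
        3 ^ k * (1 + p ^ (k + 1) / 2) ^ A.card * ∑ v, W v := by
  have hstep : ∀ u v h (a : ℕ), d u h ≤ a * d u v → d v h ≤ ((a + 1 : ℕ) : ℝ≥0∞) * d v u := by
    intro u v h a ha
    calc d v h ≤ d v u + d u h := htri v u h
      _ ≤ d v u + a * d u v := by gcongr
      _ = _ := by rw [hsymm u v]; push_cast; ring
  induction k generalizing A W with
  | zero =>
    refine ⟨fun _ => A, fun u v h hh a ha => ⟨h, hh, Or.inl rfl, ?_⟩, ?_⟩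
    · calc d u h + d v h ≤ a * d u v + ((a + 1 : ℕ) : ℝ≥0∞) * d v u :=
          add_le_add ha (hstep u v h a ha)
        _ = _ := by rw [hsymm v u]; push_cast; ring
    · simp only [zero_add, pow_one, pow_zero, one_mul]
      rw [← Finset.sum_mul, mul_comm]
  | succ k ih =>
    set x := 1 + p / 2 with hx
    set y := 1 + p ^ (k + 1) / 2 with hy
    have hy1 : 1 ≤ y := by rw [hy]; linarith [pow_pos hp0 (k + 1)]
    have hx0 : 0 < x := by positivity
    obtain ⟨s, hs, hsum⟩ := exists_sample d hp0 hp1 hy1 A hW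
    obtain ⟨H, hH, hHsum⟩ := ih s (W := fun v => W v * x ^ ((bunch d v A s).card + 1))
      (fun v => mul_nonneg (hW v) (by positivity))
    choose P hPcard hP using exists_pivot d s
    refine ⟨fun v => bunch d v A s ∪ (P v ∪ H v), fun u v h hh a ha => ?_, ?_⟩
    · by_cases hb : h ∈ bunch d v A s
      · refine ⟨h, Finset.mem_union_left _ hb, Or.inl rfl, ?_⟩
        calc d u h + d v h ≤ a * d u v + ((a + 1 : ℕ) : ℝ≥0∞) * d v u :=
              add_le_add ha (hstep u v h a ha)
          _ = ((2 * a + 1 : ℕ) : ℝ≥0∞) * d u v := by rw [hsymm v u]; push_cast; ring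
          _ ≤ _ := by
            gcongr
            omega
      · have : ∃ b ∈ s, d v b ≤ d v h := by
          by_contra! hc
          exact hb ((mem_bunch d).2 ⟨hh, hc⟩)
        obtain ⟨b, hbs, hbh⟩ := this
        obtain ⟨g, hgP, hgs, hgb⟩ := hP v b hbs
        obtain ⟨g', hg'u, hg'v, hle⟩ :=
          hH v u g hgs (a + 1) ((hgb.trans hbh).trans (hstep u v h a ha))
        refine ⟨g', ?_, Or.inr ?_, ?_⟩
        · rcases hg'v with rfl | h'
          · simp [hgP]
          · simp [h']
        · simp [hg'u]
        · rw [add_comm, hsymm u v]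
          exact hle.trans_eq (by congr 2; ring)
    · have hxle : x ≤ 3 / 2 := by rw [hx]; linarith
      have hz : 1 + p * (y - 1) = 1 + p ^ (k + 1 + 1) / 2 := by rw [hy, pow_succ p (k + 1)]; ring
      rw [hz] at hsum
      have hW0 : 0 ≤ ∑ v, W v := Finset.sum_nonneg fun v _ => hW v
      calc ∑ v, W v * x ^ (bunch d v A s ∪ (P v ∪ H v)).card
          ≤ ∑ v, W v * x ^ ((bunch d v A s).card + 1) * x ^ (H v).card := by
            refine Finset.sum_le_sum fun v _ => ?_
            rw [mul_assoc, ← pow_add]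
            refine mul_le_mul_of_nonneg_left (pow_le_pow_right₀ (by linarith) ?_) (hW v)
            have h1 := Finset.card_union_le (bunch d v A s) (P v ∪ H v)
            have h2 := Finset.card_union_le (P v) (H v)
            have h3 := hPcard v
            omega
        _ ≤ 3 ^ k * y ^ s.card * ∑ v, W v * x ^ ((bunch d v A s).card + 1) := hHsum
        _ = 3 ^ k * x * ∑ v, W v * (x ^ (bunch d v A s).card * y ^ s.card) := by
            rw [Finset.mul_sum, Finset.mul_sum]
            exact Finset.sum_congr rfl fun v _ => by rw [pow_succ]; ring
        _ ≤ 3 ^ k * (3 / 2) * ((∑ v, W v) * (2 * (1 + p ^ (k + 1 + 1) / 2) ^ A.card)) := by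
            refine mul_le_mul (by gcongr) hsum (Finset.sum_nonneg fun v _ => ?_) (by positivity)
            have := hW v
            positivity
        _ = _ := by rw [pow_succ]; ring

/-- `H` assigns hub sets that certify stretch `2 * k + 1` for all pairs with a point in `S`. -/
def IsHubs (S : Finset V) (k : ℕ) (H : V → Finset V) : Prop :=
  ∀ u ∈ S, ∀ v, ∃ g ∈ insert u (H u), g ∈ H v ∧
    d u g + d v g ≤ ((2 * k + 1 : ℕ) : ℝ≥0∞) * d u v

lemma exists_isHubs [Fintype V] (hself : ∀ u, d u u = 0) (hsymm : ∀ u v, d u v = d v u)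
    (htri : ∀ u v w, d u w ≤ d u v + d v w) {p : ℝ} (hp0 : 0 < p) (hp1 : p ≤ 1) {k : ℕ}
    {S : Finset V} (hS : p ^ (k + 1) * S.card ≤ 1) {W : V → ℝ} (hW : ∀ v, 0 ≤ W v) :
    ∃ H : V → Finset V, IsHubs d S k H ∧
      ∑ v, W v * (1 + p / 2) ^ (H v).card ≤ 3 ^ (k + 1) * ∑ v, W v := by
  obtain ⟨H, hH, hsum⟩ := exists_hierarchy d hsymm htri hp0 hp1 k S hW
  refine ⟨H, fun u hu v => ?_, hsum.trans ?_⟩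
  · obtain ⟨g, hgv, hgu, hle⟩ := hH u v u hu 0 (by simp [hself])
    exact ⟨g, Finset.mem_insert.2 hgu, hgv, by simpa using hle⟩
  · have h3 : (1 + p ^ (k + 1) / 2) ^ S.card ≤ 3 := by
      calc (1 + p ^ (k + 1) / 2) ^ S.card ≤ Real.exp (p ^ (k + 1) / 2) ^ S.card := by
            gcongr
            linarith [Real.add_one_le_exp (p ^ (k + 1) / 2)]
        _ = Real.exp (S.card * (p ^ (k + 1) / 2)) := (Real.exp_nat_mul _ _).symm
        _ ≤ Real.exp 1 := by gcongr; nlinarith [pow_pos hp0 (k + 1)]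
        _ ≤ 3 := by linarith [Real.exp_one_lt_d9]
    have hW0 : 0 ≤ ∑ v, W v := Finset.sum_nonneg fun v _ => hW v
    rw [pow_succ 3 k]
    gcongr

/-- Hub sets for several source sets at once. The point `v` needs only those of the indices
`i ≤ σ v`; their sizes are controlled jointly, by one exponential moment, because separate tail
bounds would not add up. -/
lemma exists_isHubs_family [Fintype V] (hself : ∀ u, d u u = 0) (hsymm : ∀ u v, d u v = d v u)
    (htri : ∀ u v w, d u w ≤ d u v + d v w) {p : ℕ → ℝ} (hp0 : ∀ i, 0 < p i)
    (hp1 : ∀ i, p i ≤ 1) {k : ℕ → ℕ} {S : ℕ → Finset V}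
    (hS : ∀ i, p i ^ (k i + 1) * (S i).card ≤ 1) {W : V → ℝ} (hW : ∀ v, 0 ≤ W v)
    (σ : V → ℕ) (m : ℕ) :
    ∃ H : ℕ → V → Finset V, (∀ i < m, IsHubs d (S i) (k i) (H i)) ∧
      ∑ v, W v * ∏ i ∈ Finset.range m,
        (if i ≤ σ v then (1 + p i / 2) ^ (H i v).card / 3 ^ (k i + 1) else 1) ≤ ∑ v, W v := by
  induction m with
  | zero => exact ⟨fun _ _ => ∅, by simp⟩
  | succ m ih =>
    obtain ⟨H, hH, hsum⟩ := ih
    set U : V → ℝ := fun v => W v * ∏ i ∈ Finset.range m,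
        (if i ≤ σ v then (1 + p i / 2) ^ (H i v).card / 3 ^ (k i + 1) else 1) with hU
    have hU0 : ∀ v, 0 ≤ U v := fun v => mul_nonneg (hW v) (Finset.prod_nonneg fun i _ => by
      have := hp0 i
      split_ifs <;> positivity)
    obtain ⟨K, hK, hKsum⟩ := exists_isHubs d hself hsymm htri (hp0 m) (hp1 m) (hS m)
      (W := fun v => if m ≤ σ v then U v else 0) (fun v => by
        split_ifs; exacts [hU0 v, le_rfl])
    refine ⟨fun i => if i < m then H i else K, fun i hi => ?_, le_trans ?_ hsum⟩
    · rcases Nat.lt_succ_iff_lt_or_eq.1 hi with h | rfl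
      · simpa [h] using hH i h
      · simpa using hK
    · have h3 : (0 : ℝ) < 3 ^ (k m + 1) := by positivity
      have hnew : ∀ v, (W v * ∏ i ∈ Finset.range (m + 1), (if i ≤ σ v then
          (1 + p i / 2) ^ ((if i < m then H i else K) v).card / 3 ^ (k i + 1) else 1)) =
          (if m ≤ σ v then U v else 0) * (1 + p m / 2) ^ (K v).card / 3 ^ (k m + 1) +
            (if m ≤ σ v then 0 else U v) := by
        intro v
        have hprod : ∏ i ∈ Finset.range m, (if i ≤ σ v then
            (1 + p i / 2) ^ ((if i < m then H i else K) v).card / 3 ^ (k i + 1) else 1) =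
            ∏ i ∈ Finset.range m,
              (if i ≤ σ v then (1 + p i / 2) ^ (H i v).card / 3 ^ (k i + 1) else 1) :=
          Finset.prod_congr rfl fun i hi => by rw [if_pos (Finset.mem_range.1 hi)]
        rw [Finset.prod_range_succ, hprod, ← mul_assoc]
        simp only [lt_irrefl, if_false]
        split_ifs <;> simp [hU, mul_div_assoc]
      rw [Finset.sum_congr rfl fun v _ => hnew v, Finset.sum_add_distrib, ← Finset.sum_div]
      calc _ ≤ (∑ v, if m ≤ σ v then U v else 0) + ∑ v, (if m ≤ σ v then 0 else U v) := by
            gcongr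
            rw [div_le_iff₀ h3, mul_comm]
            exact hKsum
        _ = ∑ v, U v := by
            rw [← Finset.sum_add_distrib]
            exact Finset.sum_congr rfl fun v _ => by split_ifs <;> simp

end Hubs

/-! ### The sequence of scales -/

/-- The binary logarithm of the number of sources of scale `i`: it doubles up to `t` and then
grows in steps of `t`. -/
def scaleExp (t : ℕ) : ℕ → ℕ
  | 0 => 1
  | i + 1 => scaleExp t i + min (scaleExp t i) t

/-- The first scale whose sources include the rank `j`. -/
noncomputable def scale (t j : ℕ) : ℕ := sInf {i | j ≤ 2 ^ scaleExp t i}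

section Scales

variable {t : ℕ}

lemma scaleExp_pos (i : ℕ) : 1 ≤ scaleExp t i := by
  induction i with
  | zero => simp [scaleExp]
  | succ i ih => simp only [scaleExp]; omega

lemma scaleExp_mono : Monotone (scaleExp t) :=
  monotone_nat_of_le_succ fun i => by simp only [scaleExp]; omega

lemma lt_scaleExp (ht : 1 ≤ t) (i : ℕ) : i < scaleExp t i := by
  induction i with
  | zero => simp [scaleExp]
  | succ i ih => simp only [scaleExp]; omega

lemma sum_min_scaleExp_le (m : ℕ) :
    ∑ i ∈ Finset.range m, min (scaleExp t i) t ≤ scaleExp t m := by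
  induction m with
  | zero => simp
  | succ m ih => rw [Finset.sum_range_succ]; simp only [scaleExp]; omega

lemma scaleExp_le_mul (ht : 1 ≤ t) (i : ℕ) :
    scaleExp t i ≤ (scaleExp t i / t + 1) * min (scaleExp t i) t := by
  rcases le_total (scaleExp t i) t with h | h
  · rw [min_eq_left h]
    exact Nat.le_mul_of_pos_left _ (Nat.succ_pos _)
  · rw [min_eq_right h]
    exact (Nat.lt_mul_of_div_lt (Nat.lt_succ_self _) ht).le

lemma le_two_pow_scale (ht : 1 ≤ t) (j : ℕ) : j ≤ 2 ^ scaleExp t (scale t j) :=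
  Nat.sInf_mem (s := {i | j ≤ 2 ^ scaleExp t i})
    ⟨j, Nat.lt_two_pow_self.le.trans (Nat.pow_le_pow_right (by norm_num) (lt_scaleExp ht j).le)⟩

lemma scale_mono (ht : 1 ≤ t) : Monotone (scale t) := fun _ j h =>
  Nat.sInf_le (h.trans (le_two_pow_scale ht j))

/-- A rank is not much smaller than the number of sources of its scale: passing to the scale
below loses at most a factor `2` and a summand `t` in the exponent. -/
lemma exists_scaleExp_bound {j : ℕ} (hj : 2 ≤ j) : ∃ e : ℕ, (e : ℝ) ≤ Real.logb 2 j ∧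
    scaleExp t (scale t j) ≤ 2 * e ∧ scaleExp t (scale t j) ≤ e + t := by
  have hj0 : (0 : ℝ) < j := by positivity
  rcases hs : scale t j with _ | i
  · refine ⟨1, ?_, by simp [scaleExp], by simp [scaleExp]⟩
    rw [Real.le_logb_iff_rpow_le (by norm_num) hj0]
    simpa using (by exact_mod_cast hj : (2 : ℝ) ≤ j)
  · refine ⟨scaleExp t i, ?_, by simp only [scaleExp]; omega, by simp only [scaleExp]; omega⟩
    have h : ¬ j ≤ 2 ^ scaleExp t i := fun h => by
      have : scale t j ≤ i := Nat.sInf_le h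
      omega
    rw [Real.le_logb_iff_rpow_le (by norm_num) hj0, Real.rpow_natCast]
    exact_mod_cast (not_le.1 h).le

lemma two_pow_scaleExp_div_le (ht : 1 ≤ t) {j : ℕ} (hj : 2 ≤ j) :
    (2 : ℝ) ^ (scaleExp t (scale t j) / t + 1) ≤ 4 * (j : ℝ) ^ (1 / (t : ℝ)) := by
  obtain ⟨e, he, -, hle⟩ := exists_scaleExp_bound (t := t) hj
  have ht0 : (0 : ℝ) < t := by exact_mod_cast ht
  have hdiv : ((scaleExp t (scale t j) / t : ℕ) : ℝ) ≤ e / t + 1 := by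
    refine Nat.cast_div_le.trans ?_
    rw [div_add_one ht0.ne']
    gcongr
    exact_mod_cast hle
  have hj0 : (0 : ℝ) < j := by positivity
  have hroot : (j : ℝ) ^ (1 / (t : ℝ)) = 2 ^ (Real.logb 2 j / t) := by
    conv_lhs => rw [← Real.rpow_logb (b := 2) (by norm_num) (by norm_num) hj0]
    rw [← Real.rpow_mul (by norm_num), mul_one_div]
  calc (2 : ℝ) ^ (scaleExp t (scale t j) / t + 1)
      = 2 ^ (((scaleExp t (scale t j) / t : ℕ) : ℝ) + 1) := by
        rw [← Real.rpow_natCast]; push_cast; rfl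
    _ ≤ 2 ^ (Real.logb 2 j / t + 2) := by
        refine Real.rpow_le_rpow_of_exponent_le (by norm_num) ?_
        have : (e : ℝ) / t ≤ Real.logb 2 j / t := by gcongr
        linarith
    _ = _ := by
        rw [hroot, Real.rpow_add (by norm_num)]
        norm_num
        ring

end Scales

/-! ### Prioritized hub sets -/

lemma sum_inv_mul_succ_le_one (n : ℕ) :
    ∑ v : Fin n, 1 / (((v : ℝ) + 1) * ((v : ℝ) + 2)) ≤ 1 := by
  have h : ∀ m : ℕ, ∑ i ∈ Finset.range m, 1 / (((i : ℝ) + 1) * ((i : ℝ) + 2)) =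
      1 - 1 / ((m : ℝ) + 1) := by
    intro m
    induction m with
    | zero => simp
    | succ m ih =>
      rw [Finset.sum_range_succ, ih]
      push_cast
      field_simp
      ring
  rw [Fin.sum_univ_eq_sum_range (fun i : ℕ => 1 / (((i : ℝ) + 1) * ((i : ℝ) + 2))) n, h]
  have : (0 : ℝ) ≤ 1 / ((n : ℝ) + 1) := by positivity
  linarith

/-- Turns an exponential moment bound into a size bound. -/
lemma card_le_of_pow_le {M k : ℕ} {b : ℝ} (h : (1 + (1 / 2 : ℝ) ^ k / 2) ^ M ≤ 2 ^ b) :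
    (M : ℝ) ≤ 2 * 2 ^ k * b := by
  -- Bernoulli's inequality: `(1 + 1 / R) ^ R ≥ 2` for `R = 2 ^ (k + 1)`.
  have h2 : (2 : ℝ) ≤ (1 + (1 / 2 : ℝ) ^ k / 2) ^ (2 ^ (k + 1)) := by
    have := one_add_mul_le_pow (a := (1 / 2 : ℝ) ^ k / 2)
      (by have : (0 : ℝ) < (1 / 2) ^ k := by positivity
          linarith) (2 ^ (k + 1))
    refine le_trans (le_of_eq ?_) this
    push_cast
    rw [pow_succ, one_div, inv_pow]
    field_simp
    norm_num
  have h3 : (2 : ℝ) ^ (M : ℝ) ≤ 2 ^ (b * (2 ^ (k + 1) : ℕ)) := by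
    rw [Real.rpow_natCast, Real.rpow_mul (by norm_num), Real.rpow_natCast]
    calc (2 : ℝ) ^ M ≤ ((1 + (1 / 2 : ℝ) ^ k / 2) ^ (2 ^ (k + 1))) ^ M := by gcongr
      _ = ((1 + (1 / 2 : ℝ) ^ k / 2) ^ M) ^ (2 ^ (k + 1)) := by
          rw [← pow_mul, ← pow_mul, mul_comm]
      _ ≤ _ := by gcongr
  have h4 := (Real.rpow_le_rpow_left_iff (by norm_num : (1 : ℝ) < 2)).1 h3
  push_cast at h4
  rw [pow_succ] at h4
  linarith

theorem exists_prioritized_hubs {n t : ℕ} (ht : 1 ≤ t) (d : Fin n → Fin n → ℝ≥0∞)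
    (hself : ∀ u, d u u = 0) (hsymm : ∀ u v, d u v = d v u)
    (htri : ∀ u v w, d u w ≤ d u v + d v w) :
    ∃ H : Fin n → Finset (Fin n),
      (∀ u v, ∃ g ∈ H u, g ∈ H v ∧ d u g + d v g ≤ ((2 * t - 1 : ℕ) : ℝ≥0∞) * d u v) ∧
      ∀ v : Fin n, 2 ≤ (v : ℕ) + 1 → ((H v).card : ℝ) ≤
        88 * ((((v : ℕ) + 1 : ℕ) : ℝ) ^ (1 / (t : ℝ)) *
          Real.logb 2 (((v : ℕ) + 1 : ℕ) : ℝ)) + 1 := by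
  set T : ℕ → ℕ := fun i => min (scaleExp t i) t with hT
  have hT1 : ∀ i, T i - 1 + 1 = T i := fun i => by
    have := scaleExp_pos (t := t) i
    simp only [hT]; omega
  set K : ℕ → ℕ := fun i => scaleExp t i / t + 1 with hK
  set p : ℕ → ℝ := fun i => (1 / 2) ^ K i with hp
  set S : ℕ → Finset (Fin n) := fun i =>
    Finset.univ.filter fun v => (v : ℕ) + 1 ≤ 2 ^ scaleExp t i with hSdef
  set σ : Fin n → ℕ := fun v => scale t ((v : ℕ) + 1) with hσ
  have hS : ∀ i, p i ^ (T i - 1 + 1) * ((S i).card : ℝ) ≤ 1 := by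
    intro i
    have hcard : (S i).card ≤ 2 ^ scaleExp t i := by
      have := Finset.card_le_card_of_injOn (s := S i) (t := Finset.range (2 ^ scaleExp t i))
        (fun v : Fin n => (v : ℕ)) (fun v hv => by
          have := (Finset.mem_filter.1 hv).2
          simp only [Finset.coe_range, Set.mem_Iio]
          omega) (fun a _ b _ h => Fin.ext h)
      simpa using this
    have hpow : (2 : ℝ) ^ scaleExp t i ≤ 2 ^ (K i * T i) :=
      pow_le_pow_right₀ (by norm_num) (scaleExp_le_mul ht i)
    rw [hT1, hp]
    dsimp only
    rw [← pow_mul, one_div, inv_pow, inv_mul_le_iff₀ (by positivity), mul_one]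
    refine le_trans ?_ hpow
    exact_mod_cast hcard
  have hp0 : ∀ i, 0 < p i := fun i => by positivity
  obtain ⟨H, hH, hsum⟩ := exists_isHubs_family d hself hsymm htri hp0
    (fun i => pow_le_one₀ (by norm_num) (by norm_num)) hS
    (W := fun v : Fin n => 1 / (((v : ℝ) + 1) * ((v : ℝ) + 2))) (fun v => by positivity)
    σ (Finset.univ.sup σ + 1)
  have hσlt : ∀ v, σ v < Finset.univ.sup σ + 1 := fun v =>
    Nat.lt_succ_of_le (Finset.le_sup (Finset.mem_univ v))
  refine ⟨fun v => insert v ((Finset.range (σ v + 1)).biUnion fun i => H i v), ?_, ?_⟩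
  · -- The common hub is found at the scale of the end point of smaller rank.
    have key : ∀ u v : Fin n, u ≤ v → ∃ g,
        g ∈ insert u ((Finset.range (σ u + 1)).biUnion fun i => H i u) ∧
        g ∈ insert v ((Finset.range (σ v + 1)).biUnion fun i => H i v) ∧
        d u g + d v g ≤ ((2 * t - 1 : ℕ) : ℝ≥0∞) * d u v := by
      intro u v huv
      have hu : u ∈ S (σ u) := Finset.mem_filter.2 ⟨Finset.mem_univ u, le_two_pow_scale ht _⟩
      have hle : σ u ≤ σ v := scale_mono ht (by simpa using huv)
      obtain ⟨g, hgu, hgv, hd⟩ := hH (σ u) (hσlt u) u hu v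
      refine ⟨g, ?_, ?_, hd.trans ?_⟩
      · refine Finset.insert_subset_insert u ?_ hgu
        exact Finset.subset_biUnion_of_mem (fun i => H i u) (Finset.mem_range.2 (by omega))
      · exact Finset.mem_insert_of_mem (Finset.mem_biUnion.2
          ⟨σ u, Finset.mem_range.2 (by omega), hgv⟩)
      · gcongr
        have := hT1 (σ u)
        have : T (σ u) ≤ t := min_le_right _ _
        omega
    intro u v
    rcases le_total u v with h | h
    · obtain ⟨g, h1, h2, h3⟩ := key u v h
      exact ⟨g, h1, h2, h3⟩
    · obtain ⟨g, h1, h2, h3⟩ := key v u h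
      exact ⟨g, h2, h1, by rwa [add_comm, hsymm u v]⟩
  · intro v hv
    set j : ℕ := (v : ℕ) + 1 with hj
    set M : ℕ := ∑ i ∈ Finset.range (σ v + 1), (H i v).card with hM
    have hcard : ((insert v ((Finset.range (σ v + 1)).biUnion fun i => H i v)).card : ℝ) ≤
        M + 1 := by
      exact_mod_cast (Finset.card_insert_le _ _).trans
        (Nat.add_le_add_right Finset.card_biUnion_le 1)
    refine hcard.trans (add_le_add_left ?_ 1)
    have hjpos : (0 : ℝ) < j := by positivity
    have hj2 : (2 : ℝ) ≤ j := by exact_mod_cast hv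
    -- A single term of the weighted sum is at most the whole sum.
    have hterm : ∏ i ∈ Finset.range (σ v + 1),
        ((1 + p i / 2) ^ (H i v).card / 3 ^ (T i - 1 + 1)) ≤ (j : ℝ) * (j + 1) := by
      have h1 := (Finset.single_le_sum (f := fun v : Fin n => 1 / (((v : ℝ) + 1) * ((v : ℝ) + 2)) *
        ∏ i ∈ Finset.range (Finset.univ.sup σ + 1), (if i ≤ σ v then
          (1 + p i / 2) ^ (H i v).card / 3 ^ (T i - 1 + 1) else 1))
        (fun v _ => mul_nonneg (by positivity) (Finset.prod_nonneg fun i _ => by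
          have := hp0 i
          split_ifs <;> positivity)) (Finset.mem_univ v)).trans
        (hsum.trans (sum_inv_mul_succ_le_one n))
      have h2 : ∏ i ∈ Finset.range (Finset.univ.sup σ + 1), (if i ≤ σ v then
          (1 + p i / 2) ^ (H i v).card / 3 ^ (T i - 1 + 1) else 1) =
          ∏ i ∈ Finset.range (σ v + 1),
            ((1 + p i / 2) ^ (H i v).card / 3 ^ (T i - 1 + 1)) := by
        rw [← Finset.prod_filter]
        refine Finset.prod_congr (Finset.ext fun i => ?_) fun _ _ => rfl
        have := hσlt v
        simp only [Finset.mem_filter, Finset.mem_range]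
        omega
      rw [h2, one_div, inv_mul_le_iff₀ (by positivity), mul_one] at h1
      refine h1.trans (le_of_eq ?_)
      rw [hj]; push_cast; ring
    have hmono : ∀ i ∈ Finset.range (σ v + 1), p (σ v) ≤ p i := fun i hi => by
      refine pow_le_pow_of_le_one (by norm_num) (by norm_num) ?_
      have := scaleExp_mono (t := t) (Nat.lt_succ_iff.1 (Finset.mem_range.1 hi))
      exact Nat.succ_le_succ (Nat.div_le_div_right this)
    obtain ⟨e, he, hE, -⟩ := exists_scaleExp_bound (t := t) hv
    have hTsum : ∑ i ∈ Finset.range (σ v + 1), T i ≤ 4 * e := by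
      refine (sum_min_scaleExp_le (t := t) (σ v + 1)).trans ?_
      simp only [scaleExp]
      have : scaleExp t (σ v) ≤ 2 * e := hE
      omega
    set b := Real.logb 2 (j : ℝ) with hb
    have hjb : (j : ℝ) = 2 ^ b := (Real.rpow_logb (by norm_num) (by norm_num) hjpos).symm
    have hpow : (1 + (1 / 2 : ℝ) ^ K (σ v) / 2) ^ M ≤ 2 ^ (11 * b) := by
      have h3 : (3 : ℝ) ^ (∑ i ∈ Finset.range (σ v + 1), T i) ≤ 2 ^ (8 * b) := by
        calc (3 : ℝ) ^ (∑ i ∈ Finset.range (σ v + 1), T i) ≤ 4 ^ (4 * e) := by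
              refine le_trans (pow_le_pow_right₀ (by norm_num) hTsum) ?_
              gcongr
              norm_num
          _ = 2 ^ ((8 * e : ℕ) : ℝ) := by
              rw [Real.rpow_natCast, show (4 : ℝ) = 2 ^ 2 by norm_num, ← pow_mul]
              congr 1; ring
          _ ≤ 2 ^ (8 * b) := by
              refine Real.rpow_le_rpow_of_exponent_le (by norm_num) ?_
              push_cast
              linarith
      rw [Finset.prod_div_distrib] at hterm
      simp only [hT1] at hterm
      rw [Finset.prod_pow_eq_pow_sum, div_le_iff₀ (by positivity)] at hterm
      calc (1 + (1 / 2 : ℝ) ^ K (σ v) / 2) ^ M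
          = ∏ i ∈ Finset.range (σ v + 1), (1 + p (σ v) / 2) ^ (H i v).card := by
            rw [Finset.prod_pow_eq_pow_sum]
        _ ≤ ∏ i ∈ Finset.range (σ v + 1), (1 + p i / 2) ^ (H i v).card := by
            have := hp0 (σ v)
            refine Finset.prod_le_prod (fun i _ => by positivity) fun i hi => ?_
            have := hmono i hi
            gcongr
        _ ≤ (j : ℝ) * (j + 1) * 3 ^ (∑ i ∈ Finset.range (σ v + 1), T i) := hterm
        _ ≤ (j : ℝ) ^ 3 * 2 ^ (8 * b) := by
            gcongr
            nlinarith [mul_nonneg hjpos.le (by nlinarith : 0 ≤ (j : ℝ) ^ 2 - j - 1)]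
        _ = 2 ^ (11 * b) := by
            rw [hjb, ← Real.rpow_natCast, ← Real.rpow_mul (by norm_num),
              ← Real.rpow_add (by norm_num)]
            congr 1; push_cast; ring
    have hfin := card_le_of_pow_le hpow
    have hroot := two_pow_scaleExp_div_le ht hv
    have hb0 : 0 ≤ b := le_trans (Nat.cast_nonneg e) he
    calc (M : ℝ) ≤ 2 * 2 ^ K (σ v) * (11 * b) := hfin
      _ ≤ 2 * (4 * (j : ℝ) ^ (1 / (t : ℝ))) * (11 * b) := by gcongr
      _ = _ := by ring

/-! ### The distance of a weighted graph -/

section GraphDist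

variable {V : Type*} (G : SimpleGraph V) (w : Sym2 V → ℝ≥0)

lemma graphDist_self (u : V) : graphDist G w u u = 0 :=
  le_antisymm ((iInf_le _ SimpleGraph.Walk.nil).trans (by simp [walkLength])) zero_le

lemma graphDist_comm (u v : V) : graphDist G w u v = graphDist G w v u := by
  have h : ∀ u v : V, graphDist G w u v ≤ graphDist G w v u := fun u v =>
    le_iInf fun p => (iInf_le _ p.reverse).trans (by simp [walkLength])
  exact le_antisymm (h u v) (h v u)

lemma graphDist_triangle (a b c : V) :
    graphDist G w a c ≤ graphDist G w a b + graphDist G w b c := by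
  refine ENNReal.le_iInf_add_iInf fun p q => ?_
  refine (iInf_le _ (p.append q)).trans (le_of_eq ?_)
  simp [walkLength, SimpleGraph.Walk.edges_append]

end GraphDist

/-! ### Encoding and decoding of hub labels -/

/-- The list of the hubs, each with its distance, which a label stores in consecutive words. -/
def hubEntries : Label → List (ℕ × ℝ≥0∞)
  | .num a :: .dist r :: L => (a, r) :: hubEntries L
  | _ => []

/-- As `hubEntries`, but the empty label stands for the vertex of highest priority, whose only
hub is itself (number `0`). -/
def readLabel (L : Label) : List (ℕ × ℝ≥0∞) :=
  if L = [] then [(0, 0)] else hubEntries L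

/-- The length of the shortest detour through a common hub of the two labels. -/
noncomputable def hubDecode (L L' : Label) : ℝ≥0∞ :=
  ⨅ e ∈ readLabel L, ⨅ e' ∈ readLabel L', ⨅ _ : e.1 = e'.1, e.2 + e'.2

/-- The label that stores the hubs of a list, together with the distances `f`. -/
def hubLabel {n : ℕ} (f : Fin n → ℝ≥0∞) : List (Fin n) → Label
  | [] => []
  | g :: l => .num g :: .dist (f g) :: hubLabel f l

section Labels

variable {n : ℕ} (f : Fin n → ℝ≥0∞)

lemma hubEntries_hubLabel (l : List (Fin n)) :
    hubEntries (hubLabel f l) = l.map fun g : Fin n => ((g : ℕ), f g) := by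
  induction l with
  | nil => rfl
  | cons g l ih => simp [hubLabel, hubEntries, ih]

lemma length_hubLabel (l : List (Fin n)) : (hubLabel f l).length = 2 * l.length := by
  induction l with
  | nil => rfl
  | cons g l ih => simp only [hubLabel, List.length_cons, ih]; ring

lemma mem_hubLabel {a : Word} {l : List (Fin n)} (h : a ∈ hubLabel f l) :
    ∃ g : Fin n, a = .num g ∨ a = .dist (f g) := by
  induction l with
  | nil => simp [hubLabel] at h
  | cons g l ih =>
    simp only [hubLabel, List.mem_cons] at h
    rcases h with h | h | h
    exacts [⟨g, Or.inl h⟩, ⟨g, Or.inr h⟩, ih h]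

end Labels

end DistLabel

open DistLabel in
theorem theorem8 :
    ∃ (c : ℕ) (C : ℝ), ∀ t : ℕ, 1 ≤ t →
      ∃ decode : DistLabel.Label → DistLabel.Label → ℝ≥0∞,
        ∀ (V : Type*) (n : ℕ) (G : SimpleGraph V) (w : Sym2 V → ℝ≥0) (x : Fin n ≃ V),
          ∃ label : V → DistLabel.Label,
            DistLabel.UsesWords c n G w label ∧
            DistLabel.HasStretch G w decode label ((2 * t - 1 : ℕ) : ℝ≥0∞) ∧
            DistLabel.HasPrioritizedLabelSize x label
              (fun j => C * ((j : ℝ) ^ (1 / (t : ℝ)) * Real.logb 2 (j : ℝ))) := by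
  refine ⟨1, 180, fun t ht => ⟨hubDecode, fun V n G w x => ?_⟩⟩
  set d : Fin n → Fin n → ℝ≥0∞ := fun i j => graphDist G w (x i) (x j) with hd
  have hself : ∀ i, d i i = 0 := fun i => graphDist_self G w _
  have hsymm : ∀ i j, d i j = d j i := fun i j => graphDist_comm G w _ _
  have htri : ∀ i j k, d i k ≤ d i j + d j k := fun i j k => graphDist_triangle G w _ _ _
  obtain ⟨H, hH, hcard⟩ := exists_prioritized_hubs ht d hself hsymm htri
  -- Every vertex but the first one, whose label is empty, also stores the first one as a hub.
  set lab : Fin n → Label := fun i =>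
    if hi : (i : ℕ) = 0 then [] else
      hubLabel (d i) (insert (⟨0, by omega⟩ : Fin n) (H i)).toList with hlab
  have hread0 : ∀ i : Fin n, (i : ℕ) = 0 → readLabel (lab i) = [(0, 0)] := fun i hi => by
    simp [hlab, hi, readLabel]
  have hread1 : ∀ i : Fin n, ∀ hi : (i : ℕ) ≠ 0, readLabel (lab i) =
      (insert (⟨0, by omega⟩ : Fin n) (H i)).toList.map fun g : Fin n => ((g : ℕ), d i g) := by
    intro i hi
    have hne : hubLabel (d i) (insert (⟨0, by omega⟩ : Fin n) (H i)).toList ≠ [] := by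
      intro h
      have h' := congrArg List.length h
      rw [length_hubLabel, Finset.length_toList] at h'
      have := Finset.card_pos.2 (Finset.insert_nonempty (⟨0, by omega⟩ : Fin n) (H i))
      simp only [List.length_nil] at h'
      omega
    simp only [hlab, hi, dif_neg, not_false_eq_true, readLabel, if_neg hne, hubEntries_hubLabel]
  -- What is read from a label are true distances, so decoding never underestimates.
  have hsound : ∀ i, ∀ e ∈ readLabel (lab i), ∃ g : Fin n, e.1 = g ∧ e.2 = d i g := by
    intro i e he
    by_cases hi : (i : ℕ) = 0
    · rw [hread0 i hi, List.mem_singleton] at he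
      exact ⟨i, by rw [he, hi], by rw [he, hself]⟩
    · rw [hread1 i hi, List.mem_map] at he
      obtain ⟨g, -, rfl⟩ := he
      exact ⟨g, rfl, rfl⟩
  have hlower : ∀ i j, d i j ≤ hubDecode (lab i) (lab j) := by
    intro i j
    refine le_iInf₂ fun e he => le_iInf₂ fun e' he' => le_iInf fun heq => ?_
    obtain ⟨g, h1, h2⟩ := hsound i e he
    obtain ⟨g', h1', h2'⟩ := hsound j e' he'
    have : g = g' := Fin.ext (by omega)
    rw [h2, h2', ← this, hsymm j g]
    exact htri i g j
  have hle : ∀ i j g : Fin n, ((g : ℕ), d i g) ∈ readLabel (lab i) →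
      ((g : ℕ), d j g) ∈ readLabel (lab j) → hubDecode (lab i) (lab j) ≤ d i g + d j g :=
    fun i j g h h' => (iInf₂_le _ h).trans ((iInf₂_le _ h').trans (iInf_le _ rfl))
  have hzero : ∀ i g : Fin n, (g : ℕ) = 0 → ((g : ℕ), d i g) ∈ readLabel (lab i) := by
    intro i g hg
    by_cases hi : (i : ℕ) = 0
    · have : i = g := Fin.ext (by omega)
      rw [hread0 i hi, this, hself, hg]
      simp
    · rw [hread1 i hi]
      refine List.mem_map.2 ⟨g, ?_, rfl⟩
      rw [Finset.mem_toList, Finset.mem_insert]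
      exact Or.inl (Fin.ext hg)
  have hone : (1 : ℝ≥0∞) ≤ ((2 * t - 1 : ℕ) : ℝ≥0∞) := by
    exact_mod_cast (by omega : 1 ≤ 2 * t - 1)
  have hupper : ∀ i j, hubDecode (lab i) (lab j) ≤ ((2 * t - 1 : ℕ) : ℝ≥0∞) * d i j := by
    intro i j
    by_cases hi : (i : ℕ) = 0
    · refine (hle i j i (hzero i i hi) (hzero j i hi)).trans ?_
      rw [hself, zero_add, hsymm j i]
      exact le_mul_of_one_le_left zero_le hone
    by_cases hj : (j : ℕ) = 0
    · refine (hle i j j (hzero i j hj) (hzero j j hj)).trans ?_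
      rw [hself, add_zero]
      exact le_mul_of_one_le_left zero_le hone
    obtain ⟨g, hgi, hgj, hg⟩ := hH i j
    refine (hle i j g ?_ ?_).trans hg
    · rw [hread1 i hi]
      exact List.mem_map.2 ⟨g, by simp [hgi], rfl⟩
    · rw [hread1 j hj]
      exact List.mem_map.2 ⟨g, by simp [hgj], rfl⟩
  refine ⟨fun v => lab (x.symm v), ?_, ?_, ?_⟩
  · intro v a ha
    change a ∈ lab (x.symm v) at ha
    generalize x.symm v = i at ha
    by_cases h0 : (i : ℕ) = 0
    · simp [hlab, h0] at ha
    · simp only [hlab, h0, dif_neg, not_false_eq_true] at ha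
      obtain ⟨g, rfl | rfl⟩ := mem_hubLabel _ ha
      · simpa [Word.Fits] using Nat.size_le_size g.2.le
      · exact ⟨x i, x g, rfl⟩
  · intro u v
    have h1 := hlower (x.symm u) (x.symm v)
    have h2 := hupper (x.symm u) (x.symm v)
    simp only [hd, Equiv.apply_symm_apply] at h1 h2
    exact ⟨h1, h2⟩
  · intro i
    simp only [Equiv.symm_apply_apply]
    by_cases h0 : (i : ℕ) = 0
    · simp [hlab, h0]
    · have hc := hcard i (by omega)
      have hlen : (lab i).length ≤ 2 * ((H i).card + 1) := by
        simp only [hlab, h0, dif_neg, not_false_eq_true, length_hubLabel, Finset.length_toList]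
        exact Nat.mul_le_mul_left 2 (Finset.card_insert_le _ _)
      have hlen' : ((lab i).length : ℝ) ≤ 2 * ((H i).card + 1) := by exact_mod_cast hlen
      have hj2 : (2 : ℝ) ≤ (((i : ℕ) + 1 : ℕ) : ℝ) := by
        exact_mod_cast (by omega : 2 ≤ (i : ℕ) + 1)
      have hroot : 1 ≤ (((i : ℕ) + 1 : ℕ) : ℝ) ^ (1 / (t : ℝ)) :=
        Real.one_le_rpow (by linarith) (by positivity)
      have hlog : 1 ≤ Real.logb 2 (((i : ℕ) + 1 : ℕ) : ℝ) := by
        rw [Real.le_logb_iff_rpow_le (by norm_num) (by linarith), Real.rpow_one]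
        exact hj2
      nlinarith [mul_le_mul hroot hlog zero_le_one (zero_le_one.trans hroot)]
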